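/- Let $(\mathcal C,\mathbb E,\mathfrak s)$ be an extriangulated category (in the sense of Nakaoka and Palu) with enough projectives and enough injectives. A cotorsion pair on $\mathcal C$ is a pair $(\mathcal U,\mathcal V)$ of full additive subcategories, closed under isomorphisms and direct summands, such that $\mathbb E(U,V)=0$ for all $U\in\mathcal U$, $V\in\mathcal V$, and such that every object $C$ admits conflations $V_C\to U_C\to C$ and $C\to V^C\to U^C$ with $U_C,U^C\in\mathcal U$ and $V_C,V^C\in\mathcal V$. For a subcategory $\mathcal V$, let $\Sigma\mathcal V$ be the class of objects $C$ that admit a conflation $V\to I\to C$ with $V\in\mathcal V$ and $I$ injective. For additive subcategories $\mathcal W\subseteq\mathcal P$ of $\mathcal C$, let $\mathcal P/\mathcal W$ be the category with the objects of $\mathcal P$ and with the morphisms of $\mathcal C$ modulo those that factor through an object of $\mathcal W$. A sequence $\mathcal A'\xrightarrow{F}\mathcal A\xrightarrow{G}\mathcal A''$ of additive functors between additive categories is a recollement if $F$ is fully faithful and has a left adjoint $F_\lambda$ and a right adjoint $F_\rho$, $G$ has a fully faithful left adjoint $G_\lambda$ and a fully faithful right adjoint $G_\rho$, and an object $A$ of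 $\mathcal A$ is isomorphic to some $F(X)$ if and only if $G(A)\cong 0$. Let $(\mathcal S,\mathcal T)$, $(\mathcal U,\mathcal V)$ and $(\mathcal X,\mathcal Y)$ be cotorsion pairs on $\mathcal C$ with $$\mathcal W:=\mathcal S\cap\mathcal T=\mathcal U\cap\mathcal V=\mathcal X\cap\mathcal Y,$$ and assume that $\mathcal Y\cap\mathcal S=\mathcal U$, $\mathcal X\subseteq\mathcal S$, $\Sigma\mathcal V\subseteq\mathcal V$ and $\Sigma\mathcal Y\subseteq\mathcal Y$. Let $I:\mathcal U/\mathcal W\to\mathcal S/\mathcal W$ be the inclusion. Then there are functors $J$ and $J'$ such that $$\mathcal U/\mathcal W\xrightarrow{\;I\;}\mathcal S/\mathcal W\xrightarrow{\;J\;}(\mathcal S\cap\mathcal V)/\mathcal W\qquad\text{and}\qquad \mathcal U/\mathcal W\xrightarrow{\;I\;}\mathcal S/\mathcal W\xrightarrow{\;J'\;}\mathcal X/\mathcal W$$ are recollements of additive categories, with the same adjoints $I_\lambda$ and $I_\rho$ of $I$, in which the right adjoint $J_\rho$ of $J$ is the inclusion $(\mathcal S\cap\mathcal V)/\mathcal W\to\mathcal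 S/\mathcal W$ and the left adjoint $J'_\lambda$ of $J'$ is the inclusion $\mathcal X/\mathcal W\to\mathcal S/\mathcal W$. -/

import Mathlib

open CategoryTheory CategoryTheory.Limits Opposite

open scoped ZeroObject

universe w v u

/-! ### Extriangulated categories (Nakaoka and Palu) -/

/-- The structure of an extriangulated category on the additive category `C`: a biadditive functor
`E : Cᵒᵖ × C → Ab` and an additive realization of it that satisfies the compatibility axioms
(ET3), (ET3)ᵒᵖ, (ET4), (ET4)ᵒᵖ.

The realization `𝔰` sends `δ ∈ E(C, A)` to an equivalence class of sequences `A ⟶ B ⟶ Z`. It is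
encoded by the relation `Realizes x y δ`, meaning `𝔰(δ) = [A --x--> B --y--> Z]`:
for each `δ` the realizing sequences form exactly one equivalence class
(`exists_realizes`, `realizes_iff`). -/
structure ExtriangulatedStructure (C : Type u) [Category.{v} C] [Preadditive C]
    [HasZeroObject C] [HasBinaryBiproducts C] where
  /-- the bifunctor `E`, contravariant in the first and covariant in the second variable -/
  E : Cᵒᵖ ⥤ C ⥤ AddCommGrpCat.{w}
  additive_left : E.Additive
  additive_right : ∀ Z : Cᵒᵖ, (E.obj Z).Additive
  /-- `A --x--> B --y--> Z` belongs to the class `𝔰(δ)` -/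
  Realizes : ∀ {A B Z : C}, (A ⟶ B) → (B ⟶ Z) → ((E.obj (op Z)).obj A) → Prop
  exists_realizes : ∀ {A Z : C} (δ : (E.obj (op Z)).obj A),
    ∃ (B : C) (x : A ⟶ B) (y : B ⟶ Z), Realizes x y δ
  /-- Two sequences are equivalent when there is an isomorphism of middle terms that is compatible
  with the identities of the end terms. -/
  realizes_iff : ∀ {A B B' Z : C} {x : A ⟶ B} {y : B ⟶ Z} {δ : (E.obj (op Z)).obj A},
    Realizes x y δ → ∀ (x' : A ⟶ B') (y' : B' ⟶ Z),
      (Realizes x' y' δ ↔ ∃ b : B ≅ B', x ≫ b.hom = x' ∧ b.hom ≫ y' = y)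
  /-- `𝔰` is a realization: a morphism of extensions `(a, c) : δ ⟶ δ'`, that is `a_* δ = c^* δ'`,
  lifts to a morphism of realizing sequences. -/
  exists_middle : ∀ {A B Z A' B' Z' : C} {x : A ⟶ B} {y : B ⟶ Z} {x' : A' ⟶ B'} {y' : B' ⟶ Z'}
    {δ : (E.obj (op Z)).obj A} {δ' : (E.obj (op Z')).obj A'},
    Realizes x y δ → Realizes x' y' δ' → ∀ (a : A ⟶ A') (c : Z ⟶ Z'),
      (E.obj (op Z)).map a δ = (E.map c.op).app A' δ' →
        ∃ b : B ⟶ B', x ≫ b = a ≫ x' ∧ y ≫ c = b ≫ y'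
  /-- `𝔰(0) = 0` -/
  realizes_zero : ∀ A Z : C,
    Realizes (biprod.inl : A ⟶ A ⊞ Z) (biprod.snd : A ⊞ Z ⟶ Z) (0 : (E.obj (op Z)).obj A)
  /-- `𝔰(δ ⊕ δ') = 𝔰(δ) ⊕ 𝔰(δ')`, where `δ ⊕ δ'` has the components `δ, 0, 0, δ'` -/
  realizes_biprod : ∀ {A B Z A' B' Z' : C} {x : A ⟶ B} {y : B ⟶ Z} {x' : A' ⟶ B'} {y' : B' ⟶ Z'}
    {δ : (E.obj (op Z)).obj A} {δ' : (E.obj (op Z')).obj A'},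
    Realizes x y δ → Realizes x' y' δ' →
      Realizes (biprod.map x x') (biprod.map y y')
        ((E.map (biprod.fst : Z ⊞ Z' ⟶ Z).op).app (A ⊞ A')
            ((E.obj (op Z)).map (biprod.inl : A ⟶ A ⊞ A') δ) +
          (E.map (biprod.snd : Z ⊞ Z' ⟶ Z').op).app (A ⊞ A')
            ((E.obj (op Z')).map (biprod.inr : A' ⟶ A ⊞ A') δ'))
  et3 : ∀ {A B Z A' B' Z' : C} {x : A ⟶ B} {y : B ⟶ Z} {x' : A' ⟶ B'} {y' : B' ⟶ Z'}
    {δ : (E.obj (op Z)).obj A} {δ' : (E.obj (op Z')).obj A'},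
    Realizes x y δ → Realizes x' y' δ' → ∀ (a : A ⟶ A') (b : B ⟶ B'), x ≫ b = a ≫ x' →
      ∃ c : Z ⟶ Z', y ≫ c = b ≫ y' ∧ (E.obj (op Z)).map a δ = (E.map c.op).app A' δ'
  et3_op : ∀ {A B Z A' B' Z' : C} {x : A ⟶ B} {y : B ⟶ Z} {x' : A' ⟶ B'} {y' : B' ⟶ Z'}
    {δ : (E.obj (op Z)).obj A} {δ' : (E.obj (op Z')).obj A'},
    Realizes x y δ → Realizes x' y' δ' → ∀ (b : B ⟶ B') (c : Z ⟶ Z'), y ≫ c = b ≫ y' →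
      ∃ a : A ⟶ A', x ≫ b = a ≫ x' ∧ (E.obj (op Z)).map a δ = (E.map c.op).app A' δ'
  et4 : ∀ {A B D Z F : C} {f : A ⟶ B} {f' : B ⟶ D} {g : B ⟶ Z} {g' : Z ⟶ F}
    {δ : (E.obj (op D)).obj A} {δ' : (E.obj (op F)).obj B},
    Realizes f f' δ → Realizes g g' δ' →
      ∃ (K : C) (d : D ⟶ K) (e : K ⟶ F) (h' : Z ⟶ K) (δ'' : (E.obj (op K)).obj A),
        f' ≫ d = g ≫ h' ∧ h' ≫ e = g' ∧ Realizes (f ≫ g) h' δ'' ∧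
        Realizes d e ((E.obj (op F)).map f' δ') ∧
        (E.map d.op).app A δ'' = δ ∧
        (E.obj (op K)).map f δ'' = (E.map e.op).app B δ'
  et4_op : ∀ {A B D Z F : C} {f' : D ⟶ A} {f : A ⟶ B} {g' : F ⟶ B} {g : B ⟶ Z}
    {δ : (E.obj (op B)).obj D} {δ' : (E.obj (op Z)).obj F},
    Realizes f' f δ → Realizes g' g δ' →
      ∃ (K : C) (d : D ⟶ K) (e : K ⟶ F) (h' : K ⟶ A) (δ'' : (E.obj (op Z)).obj K),
        d ≫ h' = f' ∧ e ≫ g' = h' ≫ f ∧ Realizes h' (f ≫ g) δ'' ∧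
        Realizes d e ((E.map g'.op).app D δ) ∧
        (E.obj (op Z)).map e δ'' = δ' ∧
        (E.obj (op B)).map d δ = (E.map g.op).app K δ''

namespace ExtriangulatedStructure

variable {C : Type u} [Category.{v} C] [Preadditive C] [HasZeroObject C]
  [HasBinaryBiproducts C]
  (𝓔 : ExtriangulatedStructure.{w} C)

/-- `A --x--> B --y--> Z` is a conflation, that is, it realizes some extension. -/
def Conflation {A B Z : C} (x : A ⟶ B) (y : B ⟶ Z) : Prop :=
  ∃ δ : (𝓔.E.obj (op Z)).obj A, 𝓔.Realizes x y δ

/-- `P` is projective. -/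
def IsProj (P : C) : Prop :=
  ∀ ⦃A B Z : C⦄ (x : A ⟶ B) (y : B ⟶ Z), 𝓔.Conflation x y →
    ∀ c : P ⟶ Z, ∃ b : P ⟶ B, b ≫ y = c

/-- `I` is injective. -/
def IsInj (I : C) : Prop :=
  ∀ ⦃A B Z : C⦄ (x : A ⟶ B) (y : B ⟶ Z), 𝓔.Conflation x y →
    ∀ a : A ⟶ I, ∃ b : B ⟶ I, x ≫ b = a

/-- Each object `Z` has a conflation `A ⟶ P ⟶ Z` with `P` projective. -/
def EnoughProj : Prop :=
  ∀ Z : C, ∃ (A P : C) (x : A ⟶ P) (y : P ⟶ Z), 𝓔.IsProj P ∧ 𝓔.Conflation x y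

/-- Each object `A` has a conflation `A ⟶ I ⟶ Z` with `I` injective. -/
def EnoughInj : Prop :=
  ∀ A : C, ∃ (I Z : C) (x : A ⟶ I) (y : I ⟶ Z), 𝓔.IsInj I ∧ 𝓔.Conflation x y

/-- The cosyzygy `ΣV`: all objects `Z` that admit a conflation `A ⟶ I ⟶ Z` with `A` in `V`
and `I` injective. -/
def cosyzygy (V : ObjectProperty C) : ObjectProperty C := fun Z =>
  ∃ (A I : C) (x : A ⟶ I) (y : I ⟶ Z), V A ∧ 𝓔.IsInj I ∧ 𝓔.Conflation x y

/-- `(U, V)` is a cotorsion pair. The two subcategories are to be full additive subcategories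
closed under isomorphisms and direct summands, see `IsAdditiveSubcategory`. -/
structure IsCotorsionPair (U V : ObjectProperty C) : Prop where
  ext_eq_zero : ∀ ⦃A B : C⦄, U A → V B → ∀ δ : (𝓔.E.obj (op A)).obj B, δ = 0
  exists_left : ∀ Z : C, ∃ (B A : C) (x : B ⟶ A) (y : A ⟶ Z), V B ∧ U A ∧ 𝓔.Conflation x y
  exists_right : ∀ Z : C, ∃ (B A : C) (x : Z ⟶ B) (y : B ⟶ A), V B ∧ U A ∧ 𝓔.Conflation x y

end ExtriangulatedStructure

/-! ### Subcategories and quotients -/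

section Subcategories

variable {C : Type u} [Category.{v} C] [Preadditive C] [HasZeroObject C]
  [HasBinaryBiproducts C]

/-- The full subcategory of objects satisfying `P` is an additive subcategory that is closed under
isomorphisms and direct summands. -/
class IsAdditiveSubcategory (P : ObjectProperty C) : Prop where
  iso_mem : ∀ {A B : C}, (A ≅ B) → P A → P B
  zero_mem : ∀ {A : C}, IsZero A → P A
  biprod_mem : ∀ {A B : C}, P A → P B → P (A ⊞ B)
  summand_mem : ∀ {A B : C}, P (A ⊞ B) → P A

instance IsAdditiveSubcategory.inf (P Q : ObjectProperty C) [IsAdditiveSubcategory P]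
    [IsAdditiveSubcategory Q] : IsAdditiveSubcategory (P ⊓ Q) where
  iso_mem e h := ⟨iso_mem e h.1, iso_mem e h.2⟩
  zero_mem h := ⟨zero_mem h, zero_mem h⟩
  biprod_mem h h' := ⟨biprod_mem h.1 h'.1, biprod_mem h.2 h'.2⟩
  summand_mem h := ⟨summand_mem h.1, summand_mem h.2⟩

/-- `f` factors through an object of `W`. -/
def FactorsThrough (W : ObjectProperty C) {A B : C} (f : A ⟶ B) : Prop :=
  ∃ (Z : C) (a : A ⟶ Z) (b : Z ⟶ B), W Z ∧ a ≫ b = f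

/-- Congruence modulo the ideal of the morphisms that factor through an object of `W`. -/
def idealRel (W : ObjectProperty C) : HomRel C := fun _ _ f g => FactorsThrough W (f - g)

variable (W : ObjectProperty C) [IsAdditiveSubcategory W]

theorem FactorsThrough.sum {A B : C} {f g : A ⟶ B} (hf : FactorsThrough W f)
    (hg : FactorsThrough W g) : FactorsThrough W (f + g) := by
  obtain ⟨Z, a, b, hZ, rfl⟩ := hf
  obtain ⟨Z', a', b', hZ', rfl⟩ := hg
  exact ⟨Z ⊞ Z', biprod.lift a a', biprod.desc b b', IsAdditiveSubcategory.biprod_mem hZ hZ',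
    biprod.lift_desc⟩

instance idealRel_congruence : Congruence (idealRel W) where
  equivalence :=
    { refl := fun f => ⟨0, 0, 0, IsAdditiveSubcategory.zero_mem (isZero_zero C), by simp⟩
      symm := by
        rintro f g ⟨Z, a, b, hZ, h⟩
        exact ⟨Z, -a, b, hZ, by rw [Preadditive.neg_comp, h, neg_sub]⟩
      trans := by
        intro f g h h₁ h₂
        have := FactorsThrough.sum W h₁ h₂
        rwa [sub_add_sub_cancel] at this }
  comp_left := by
    rintro A B D f g g' ⟨Z, a, b, hZ, h⟩
    exact ⟨Z, f ≫ a, b, hZ, by rw [Category.assoc, h, Preadditive.comp_sub]⟩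
  comp_right := by
    rintro A B D f f' g ⟨Z, a, b, hZ, h⟩
    exact ⟨Z, a, b ≫ g, hZ, by rw [← Category.assoc, h, Preadditive.sub_comp]⟩

theorem idealRel_sum ⦃A B : C⦄ (f₁ f₂ g₁ g₂ : A ⟶ B) (hf : idealRel W f₁ f₂)
    (hg : idealRel W g₁ g₂) : idealRel W (f₁ + g₁) (f₂ + g₂) := by
  have := FactorsThrough.sum W hf hg
  rwa [sub_add_sub_comm] at this

/-- The quotient category `C/W`. -/
abbrev IdealQuotient : Type u := CategoryTheory.Quotient (idealRel W)

/-- The quotient functor `C ⥤ C/W`. -/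
abbrev toIdealQuotient : C ⥤ IdealQuotient W := CategoryTheory.Quotient.functor (idealRel W)

instance idealQuotientPreadditive : Preadditive (IdealQuotient W) :=
  CategoryTheory.Quotient.preadditive (idealRel W) (idealRel_sum W)

instance toIdealQuotient_additive : (toIdealQuotient W).Additive :=
  CategoryTheory.Quotient.functor_additive (idealRel W) (idealRel_sum W)

/-- `f` and `g` agree in `C/W` exactly when `f - g` factors through an object of `W`. -/
theorem toIdealQuotient_map_eq_iff {A B : C} (f g : A ⟶ B) :
    (toIdealQuotient W).map f = (toIdealQuotient W).map g ↔ FactorsThrough W (f - g) :=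
  CategoryTheory.Quotient.functor_map_eq_iff (idealRel W) f g

/-- The objects of `C/W` that come from objects of `P`. -/
def quotientProperty (P : ObjectProperty C) : ObjectProperty (IdealQuotient W) := fun A => P A.as

/-- The category `P/W`, as the full subcategory of `C/W` on the objects of `P`: its morphisms are
the morphisms of `C` between objects of `P`, modulo those that factor through an object of `W`.
(It is used for `W ≤ P` only; the factorizations then stay inside `P`.) -/
abbrev QuotientSubcategory (P : ObjectProperty C) : Type u := (quotientProperty W P).FullSubcategory

/-- `P/W` is again an additive category: it has binary biproducts and a zero object. -/
instance quotientSubcategory_hasBinaryBiproducts (P : ObjectProperty C) [IsAdditiveSubcategory P] :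
    HasBinaryBiproducts (QuotientSubcategory W P) := ⟨by
  intro A B
  let Q := toIdealQuotient W
  let pt : QuotientSubcategory W P :=
    ⟨⟨A.obj.as ⊞ B.obj.as⟩, IsAdditiveSubcategory.biprod_mem A.property B.property⟩
  let b : BinaryBicone A B :=
    { pt := pt
      fst := ObjectProperty.homMk (Q.map biprod.fst)
      snd := ObjectProperty.homMk (Q.map biprod.snd)
      inl := ObjectProperty.homMk (Q.map biprod.inl)
      inr := ObjectProperty.homMk (Q.map biprod.inr)
      inl_fst := by
        apply ObjectProperty.hom_ext
        exact (Q.map_comp _ _).symm.trans ((congrArg Q.map biprod.inl_fst).trans (Q.map_id _))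
      inl_snd := by
        apply ObjectProperty.hom_ext
        exact (Q.map_comp _ _).symm.trans ((congrArg Q.map biprod.inl_snd).trans (Q.map_zero _ _))
      inr_fst := by
        apply ObjectProperty.hom_ext
        exact (Q.map_comp _ _).symm.trans ((congrArg Q.map biprod.inr_fst).trans (Q.map_zero _ _))
      inr_snd := by
        apply ObjectProperty.hom_ext
        exact (Q.map_comp _ _).symm.trans ((congrArg Q.map biprod.inr_snd).trans (Q.map_id _)) }
  refine hasBinaryBiproduct_of_total b ?_
  apply ObjectProperty.hom_ext
  have h := congrArg Q.map (biprod.total (X := A.obj.as) (Y := B.obj.as))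
  rw [Q.map_add, Q.map_comp, Q.map_comp, Q.map_id] at h
  exact h⟩

instance quotientSubcategory_hasZeroObject (P : ObjectProperty C) [IsAdditiveSubcategory P] :
    HasZeroObject (QuotientSubcategory W P) :=
  ⟨⟨⟨(0 : C)⟩, (IsAdditiveSubcategory.zero_mem (isZero_zero C) : P (0 : C))⟩, by
    rw [IsZero.iff_id_eq_zero]
    apply ObjectProperty.hom_ext
    have h := congrArg (toIdealQuotient W).map ((isZero_zero C).eq_of_src (𝟙 _) 0)
    exact ((toIdealQuotient W).map_id _).symm.trans (h.trans ((toIdealQuotient W).map_zero _ _))⟩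

variable {W} in
/-- The inclusion functor `P/W ⥤ Q/W` for `P ≤ Q`; it is a full embedding. -/
abbrev quotientInclusion {P Q : ObjectProperty C} (h : P ≤ Q) :
    QuotientSubcategory W P ⥤ QuotientSubcategory W Q :=
  ObjectProperty.ιOfLE (P := quotientProperty W P) (P' := quotientProperty W Q) (fun A hA => h A.as hA)

end Subcategories

/-! ### Recollements of additive categories -/

section Recollements

universe v₁ u₁ v₂ u₂ v₃ u₃

variable {A' : Type u₁} [Category.{v₁} A'] [Preadditive A'] [HasZeroObject A']
    [HasBinaryBiproducts A']
  {A : Type u₂} [Category.{v₂} A] [Preadditive A] [HasZeroObject A]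
    [HasBinaryBiproducts A]
  {A'' : Type u₃} [Category.{v₃} A''] [Preadditive A''] [HasZeroObject A'']
    [HasBinaryBiproducts A'']

/-- The sequence of additive functors `A' --F--> A --G--> A''` is a localization sequence, with the
given right adjoints `Fρ` and `Gρ`. (Adjoints of additive functors are additive.) -/
structure LocalizationSequence (F : A' ⥤ A) (G : A ⥤ A'') where
  F_additive : F.Additive
  G_additive : G.Additive
  F_full : F.Full
  F_faithful : F.Faithful
  Fρ : A ⥤ A'
  adjF : F ⊣ Fρ
  Gρ : A'' ⥤ A
  adjG : G ⊣ Gρ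
  Gρ_full : Gρ.Full
  Gρ_faithful : Gρ.Faithful
  /-- `Im F = Ker G` -/
  im_eq_ker : ∀ M : A, F.essImage M ↔ IsZero (G.obj M)

/-- The sequence of additive functors `A' --F--> A --G--> A''` is a colocalization sequence, with
the given left adjoints `Fl` and `Gl`. -/
structure ColocalizationSequence (F : A' ⥤ A) (G : A ⥤ A'') where
  F_additive : F.Additive
  G_additive : G.Additive
  F_full : F.Full
  F_faithful : F.Faithful
  Fl : A ⥤ A'
  adjF : Fl ⊣ F
  Gl : A'' ⥤ A
  adjG : Gl ⊣ G
  Gl_full : Gl.Full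
  Gl_faithful : Gl.Faithful
  /-- `Im F = Ker G` -/
  im_eq_ker : ∀ M : A, F.essImage M ↔ IsZero (G.obj M)

/-- A recollement of additive categories `A' --F--> A --G--> A''`. -/
structure Recollement (F : A' ⥤ A) (G : A ⥤ A'') where
  loc : LocalizationSequence F G
  coloc : ColocalizationSequence F G

end Recollements

/-! Modulo the core `W` of a cotorsion pair `(U, V)`, every map from `U` to `V` vanishes, so the
approximations of an object by `U` and by `V` become functorial and are adjoint to the inclusions.
Applied to `S/W`, `(U, V)` gives `I_ρ` and a reflection `J` onto `(S ∩ V)/W`, while `(X, Y)` gives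
`I_λ` (because `Y ∩ S = U`) and a coreflection `J'` onto `X/W`.

The missing left adjoint of `J` and right adjoint of `J'` come from comparing the two functors: `J'`
inverts the unit of `J`, and `J` inverts the counit of `J'`. Hence `X/W` and `(S ∩ V)/W` are
equivalent, `J` and `J'` agree up to this equivalence, and each inherits the adjoint of the other
(`exists_adjoint_triples`).

The inversion statements are `bijective_comp_inflation` and `bijective_comp_deflation`. The
approximating conflation is replaced by one whose middle term gains a summand from `W`, invisible in
the quotient, and whose other outer term is orthogonal to the test objects. That this outer term
lies in the right class uses `ΣV ⊆ V` and `ΣY ⊆ Y`, which make `U` closed under cocones and `Y`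
closed under cones. Closure of `U` under cocones also identifies the kernel of `J` with `U/W`. -/

set_option linter.unusedSectionVars false

/-! ### Functoriality of extensions. -/

namespace ExtriangulatedStructure

variable {C : Type u} [Category.{v} C] [Preadditive C] [HasZeroObject C]
  [HasBinaryBiproducts C] (𝓔 : ExtriangulatedStructure.{w} C)

/-- The group of extensions of `Z` by `A`. -/
abbrev Ext (Z A : C) : Type w := (𝓔.E.obj (op Z)).obj A

variable {𝓔}

/-- The extension `a_* δ`. -/
def push {A A' Z : C} (a : A ⟶ A') (δ : 𝓔.Ext Z A) : 𝓔.Ext Z A' := (𝓔.E.obj (op Z)).map a δ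

/-- The extension `c^* δ`. -/
def pull {A Z Z' : C} (c : Z' ⟶ Z) (δ : 𝓔.Ext Z A) : 𝓔.Ext Z' A := (𝓔.E.map c.op).app A δ

theorem push_id {A Z : C} (δ : 𝓔.Ext Z A) : push (𝟙 A) δ = δ := by
  simp [push]

theorem pull_id {A Z : C} (δ : 𝓔.Ext Z A) : pull (𝟙 Z) δ = δ := by
  simp [pull]

theorem push_comp {A A' A'' Z : C} (a : A ⟶ A') (a' : A' ⟶ A'') (δ : 𝓔.Ext Z A) :
    push (a ≫ a') δ = push a' (push a δ) := by
  simp [push]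

theorem pull_comp {A Z Z' Z'' : C} (c : Z' ⟶ Z) (c' : Z'' ⟶ Z') (δ : 𝓔.Ext Z A) :
    pull (c' ≫ c) δ = pull c' (pull c δ) := by
  simp [pull]

theorem push_pull {A A' Z Z' : C} (a : A ⟶ A') (c : Z' ⟶ Z) (δ : 𝓔.Ext Z A) :
    push a (pull c δ) = pull c (push a δ) :=
  (ConcreteCategory.congr_hom ((𝓔.E.map c.op).naturality a) δ).symm

@[simp]
theorem push_zero {A A' Z : C} (a : A ⟶ A') : push a (0 : 𝓔.Ext Z A) = 0 := map_zero _

@[simp]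
theorem pull_zero {A Z Z' : C} (c : Z' ⟶ Z) : pull c (0 : 𝓔.Ext Z A) = 0 := map_zero _

/-! ### Split conflations and exact sequences. -/

section Splitting

theorem realizes_of_splitting {A B Z : C} {x : A ⟶ B} {y : B ⟶ Z} (r : B ⟶ A) (s : Z ⟶ B)
    (hxr : x ≫ r = 𝟙 A) (hsy : s ≫ y = 𝟙 Z) (hxy : x ≫ y = 0) (hsr : s ≫ r = 0)
    (h : r ≫ x + y ≫ s = 𝟙 B) : 𝓔.Realizes x y 0 := by
  rw [𝓔.realizes_iff (𝓔.realizes_zero A Z)]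
  refine ⟨⟨biprod.desc x s, biprod.lift r y, ?_, ?_⟩, ?_, ?_⟩
  · ext <;> simp [hxr, hsy, hxy, hsr]
  · simp [h]
  · simp
  · ext <;> simp [hxy, hsy]

theorem realizes_id_zero (A : C) : 𝓔.Realizes (𝟙 A) (0 : A ⟶ 0) 0 :=
  realizes_of_splitting (𝟙 A) 0 (by simp) ((isZero_zero C).eq_of_src _ _) (by simp) (by simp)
    (by simp)

theorem realizes_zero_id (Z : C) : 𝓔.Realizes (0 : 0 ⟶ Z) (𝟙 Z) 0 :=
  realizes_of_splitting 0 (𝟙 Z) ((isZero_zero C).eq_of_src _ _) (by simp) (by simp) (by simp)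
    (by simp)

variable {A B Z : C} {x : A ⟶ B} {y : B ⟶ Z}

theorem exists_iso_biprod (h : 𝓔.Realizes x y 0) :
    ∃ b : A ⊞ Z ≅ B, biprod.inl ≫ b.hom = x ∧ b.hom ≫ y = biprod.snd :=
  (𝓔.realizes_iff (𝓔.realizes_zero A Z) x y).1 h

variable {δ : 𝓔.Ext Z A}

theorem Realizes.comp_eq_zero (h : 𝓔.Realizes x y δ) : x ≫ y = 0 := by
  obtain ⟨c, hc, -⟩ := 𝓔.et3 (realizes_id_zero A) h (𝟙 A) x rfl
  simpa using hc.symm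

/-- The map `A ⊞ B ⟶ B` given by `x` and the identity compares the split extension with `δ`, so
(ET3)ᵒᵖ writes `pull y δ` as a pushforward of zero. -/
theorem Realizes.pull_eq_zero (h : 𝓔.Realizes x y δ) : pull y δ = 0 := by
  obtain ⟨a, -, ha⟩ := 𝓔.et3_op (𝓔.realizes_zero A B) h (biprod.desc x (𝟙 B)) y
    (by ext <;> simp [Realizes.comp_eq_zero h])
  exact ha.symm.trans (push_zero a)

theorem Realizes.push_eq_zero (h : 𝓔.Realizes x y δ) : push x δ = 0 := by
  obtain ⟨c, -, hc⟩ := 𝓔.et3 h (𝓔.realizes_zero B Z) x (biprod.lift (𝟙 B) y)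
    (by ext <;> simp [Realizes.comp_eq_zero h])
  exact hc.trans (pull_zero c)

theorem Realizes.exists_lift (h : 𝓔.Realizes x y δ) {M : C} (f : M ⟶ Z) (hf : pull f δ = 0) :
    ∃ g : M ⟶ B, g ≫ y = f := by
  obtain ⟨b, -, hb⟩ := 𝓔.exists_middle (𝓔.realizes_zero A M) h (𝟙 A) f
    ((push_zero _).trans hf.symm)
  exact ⟨biprod.inr ≫ b, by simp [← hb]⟩

theorem Realizes.exists_extend (h : 𝓔.Realizes x y δ) {M : C} (f : A ⟶ M) (hf : push f δ = 0) :
    ∃ g : B ⟶ M, x ≫ g = f := by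
  obtain ⟨b, hb, -⟩ := 𝓔.exists_middle h (𝓔.realizes_zero M Z) f (𝟙 Z)
    (hf.trans (pull_zero _).symm)
  exact ⟨b ≫ biprod.fst, by simp [reassoc_of% hb]⟩

theorem Realizes.exists_factor_left (h : 𝓔.Realizes x y δ) {M : C} (f : M ⟶ B)
    (hf : f ≫ y = 0) : ∃ g : M ⟶ A, g ≫ x = f := by
  obtain ⟨a, ha, -⟩ := 𝓔.et3_op (realizes_id_zero M) h f 0 (by simp [hf])
  exact ⟨a, by simpa using ha.symm⟩

theorem Realizes.exists_factor_right (h : 𝓔.Realizes x y δ) {M : C} (f : B ⟶ M)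
    (hf : x ≫ f = 0) : ∃ g : Z ⟶ M, y ≫ g = f := by
  obtain ⟨c, hc, -⟩ := 𝓔.et3 h (realizes_zero_id M) 0 f (by simp [hf])
  exact ⟨c, by simpa using hc⟩

/-- The sequence `E(M, A) ⟶ E(M, B) ⟶ E(M, Z)` is exact. -/
theorem Realizes.exists_push_eq (h : 𝓔.Realizes x y δ) {M : C} (β : 𝓔.Ext M B)
    (hβ : push y β = 0) : ∃ α : 𝓔.Ext M A, push x α = β := by
  obtain ⟨N, g, g', hg⟩ := 𝓔.exists_realizes β
  -- (ET4) yields a conflation `Z ⟶ K ⟶ M` realizing `push y β = 0`. It splits, and pulling `δ''`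
  -- back along a section gives the preimage.
  obtain ⟨K, d, e, h', δ'', -, -, -, hde, -, he⟩ := 𝓔.et4 h hg
  obtain ⟨s, hs⟩ := Realizes.exists_lift hde (𝟙 M) ((pull_id _).trans hβ)
  refine ⟨pull s δ'', ?_⟩
  rw [push_pull]
  refine (congrArg (pull s) he).trans ?_
  exact (pull_comp e s β).symm.trans (by rw [hs, pull_id])

/-- The sequence `E(Z, M) ⟶ E(B, M) ⟶ E(A, M)` is exact. -/
theorem Realizes.exists_pull_eq (h : 𝓔.Realizes x y δ) {M : C} (β : 𝓔.Ext B M)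
    (hβ : pull x β = 0) : ∃ α : 𝓔.Ext Z M, pull y α = β := by
  obtain ⟨N, g, g', hg⟩ := 𝓔.exists_realizes β
  obtain ⟨K, d, e, h', δ'', -, -, -, hde, -, he⟩ := 𝓔.et4_op hg h
  obtain ⟨s, hs⟩ := Realizes.exists_extend hde (𝟙 M) ((push_id _).trans hβ)
  refine ⟨push s δ'', ?_⟩
  rw [← push_pull]
  refine (congrArg (push s) he.symm).trans ?_
  exact (push_comp d s β).symm.trans (by rw [hs, push_id])

theorem eq_zero_of_section {A B Z : C} {x : A ⟶ B} {y : B ⟶ Z} {δ : 𝓔.Ext Z A}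
    (h : 𝓔.Realizes x y δ) (s : Z ⟶ B) (hs : s ≫ y = 𝟙 Z) : δ = 0 := by
  rw [← pull_id δ, ← hs, pull_comp, Realizes.pull_eq_zero h, pull_zero]

end Splitting

/-! ### Isomorphic extensions have isomorphic realizations. -/

section Isomorphisms

variable {A B Z A' B' Z' : C} {x : A ⟶ B} {y : B ⟶ Z} {x' : A' ⟶ B'} {y' : B' ⟶ Z'}
  {δ : 𝓔.Ext Z A} {δ' : 𝓔.Ext Z' A'}

/-- The five lemma. -/
theorem isIso_middle (h : 𝓔.Realizes x y δ) (h' : 𝓔.Realizes x' y' δ') (a : A ≅ A')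
    (c : Z ≅ Z') (hδ : push a.hom δ = pull c.hom δ') (b : B ⟶ B')
    (hx : x ≫ b = a.hom ≫ x') (hy : y ≫ c.hom = b ≫ y') : IsIso b := by
  have hδ₁ : pull c.inv (push a.hom δ) = δ' := by
    rw [hδ, ← pull_comp, Iso.inv_hom_id, pull_id]
  have hδ₂ : push a.inv (pull c.hom δ') = δ := by
    rw [← hδ, ← push_comp, Iso.hom_inv_id, push_id]
  -- `t` inverts `b` from one side up to a map through `x'`, and `r` from the other side up to a map
  -- through `y`. The corrections `p` and `q` make both one-sided inverses exact, so they coincide.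
  obtain ⟨t, ht⟩ := Realizes.exists_lift h (y' ≫ c.inv) (by
    rw [← hδ₂, ← push_pull, ← pull_comp, Category.assoc, Iso.inv_hom_id, Category.comp_id,
      Realizes.pull_eq_zero h', push_zero])
  obtain ⟨p, hp⟩ := Realizes.exists_factor_left h' (𝟙 B' - t ≫ b) (by
    rw [Preadditive.sub_comp, Category.assoc, ← hy, reassoc_of% ht]; simp)
  obtain ⟨r, hr⟩ := Realizes.exists_extend h' (a.inv ≫ x) (by
    rw [← hδ₁, push_pull, ← push_comp, Iso.hom_inv_id_assoc, Realizes.push_eq_zero h, pull_zero])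
  obtain ⟨q, hq⟩ := Realizes.exists_factor_right h (𝟙 B - b ≫ r) (by
    rw [Preadditive.comp_sub, ← Category.assoc, hx, Category.assoc, hr]; simp)
  have h₁ : (t + p ≫ a.inv ≫ x) ≫ b = 𝟙 B' := by
    simp [hx, hp]
  have h₂ : b ≫ (r + y' ≫ c.inv ≫ q) = 𝟙 B := by
    simp [← reassoc_of% hy, hq]
  have h₃ : t + p ≫ a.inv ≫ x = r + y' ≫ c.inv ≫ q := by
    rw [← Category.comp_id (t + _), ← h₂, ← Category.assoc, h₁, Category.id_comp]
  exact ⟨t + p ≫ a.inv ≫ x, h₃ ▸ h₂, h₁⟩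

theorem Realizes.of_iso (h : 𝓔.Realizes x y δ) (a : A ≅ A') (c : Z ≅ Z')
    (hδ : push a.hom δ = pull c.hom δ') : 𝓔.Realizes (a.inv ≫ x) (y ≫ c.hom) δ' := by
  obtain ⟨M, p, q, hpq⟩ := 𝓔.exists_realizes δ'
  obtain ⟨b, hb, hb'⟩ := 𝓔.exists_middle h hpq a.hom c.hom hδ
  have := isIso_middle h hpq a c hδ b hb hb'
  rw [𝓔.realizes_iff hpq]
  refine ⟨(asIso b).symm, ?_, ?_⟩
  · simp [IsIso.comp_inv_eq, hb]
  · simp [hb']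

end Isomorphisms

/-! ### Conflations from pushout and pullback squares. -/

section Pushout

/-- A morphism of extensions `(f, b, 1)` gives the conflation `A ⟶ D ⊞ B ⟶ N`. -/
theorem exists_conflation_of_push {A B Z D N : C} {x : A ⟶ B} {y : B ⟶ Z} {δ : 𝓔.Ext Z A}
    (h : 𝓔.Realizes x y δ) (f : A ⟶ D) {d : D ⟶ N} {e : N ⟶ Z}
    (hd : 𝓔.Realizes d e (push f δ)) :
    ∃ (i : A ⟶ D ⊞ B) (p : D ⊞ B ⟶ N), biprod.inl ≫ p = d ∧ 𝓔.Conflation i p := by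
  -- The desired inflation is the split inflation `A ⟶ D ⊞ A` followed by `D ⊞ A ⟶ D ⊞ B`. By (ET4)
  -- its cone realizes `push f δ`, so it is isomorphic to `N`.
  have h₁ : 𝓔.Realizes (biprod.lift (-f) (𝟙 A)) (biprod.desc (𝟙 D) f) 0 := by
    refine realizes_of_splitting biprod.snd biprod.inl ?_ ?_ ?_ ?_ ?_
    case refine_5 => ext <;> simp
    all_goals simp
  have h₂ : 𝓔.Realizes (biprod.map (𝟙 D) x) (biprod.snd ≫ y) (push (biprod.inr : A ⟶ D ⊞ A) δ) := by
    have := Realizes.of_iso (𝓔.realizes_biprod (realizes_id_zero D) h) (Iso.refl _)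
      (⟨biprod.snd, biprod.inr, by ext; simp, by simp⟩ :
        (0 : C) ⊞ Z ≅ Z) (δ' := push biprod.inr δ) ?_
    · simpa using this
    · refine (push_id _).trans ?_
      rw [map_zero, map_zero, zero_add]
      rfl
  obtain ⟨K, d', e', h', δ'', hdg, -, hK, hK', -⟩ := 𝓔.et4 h₁ h₂
  have hK'' : 𝓔.Realizes d' e' (push f δ) := by
    have : push (biprod.desc (𝟙 D) f) (push biprod.inr δ) = push f δ := by
      rw [← push_comp, biprod.inr_desc]
    exact this ▸ hK'
  obtain ⟨b, hb, -⟩ := (𝓔.realizes_iff hK'' d e).1 hd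
  refine ⟨biprod.lift (-f) (𝟙 A) ≫ biprod.map (𝟙 D) x, h' ≫ b.hom, ?_, pull b.inv δ'', ?_⟩
  · have := biprod.inl ≫= hdg
    rw [← hb]
    simpa using this.symm =≫ b.hom
  · simpa using Realizes.of_iso hK (Iso.refl A) b (δ' := pull b.inv δ'')
      (by rw [← pull_comp, b.hom_inv_id, pull_id]; exact push_id _)

/-- A morphism of extensions `(1, b, f)` gives the conflation `N ⟶ D ⊞ B ⟶ Z`. -/
theorem exists_conflation_of_pull {A B Z D N : C} {x : A ⟶ B} {y : B ⟶ Z} {δ : 𝓔.Ext Z A}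
    (h : 𝓔.Realizes x y δ) (f : D ⟶ Z) {d : A ⟶ N} {e : N ⟶ D}
    (hd : 𝓔.Realizes d e (pull f δ)) :
    ∃ (i : N ⟶ D ⊞ B) (p : D ⊞ B ⟶ Z), i ≫ biprod.fst = e ∧ 𝓔.Conflation i p := by
  have h₁ : 𝓔.Realizes (biprod.lift (𝟙 D) f) (biprod.desc (-f) (𝟙 Z)) 0 := by
    refine realizes_of_splitting biprod.fst biprod.inr ?_ ?_ ?_ ?_ ?_
    case refine_5 => ext <;> simp
    all_goals simp
  have h₂ : 𝓔.Realizes (x ≫ biprod.inr) (biprod.map (𝟙 D) y) (pull (biprod.snd : D ⊞ Z ⟶ Z) δ) := by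
    have := Realizes.of_iso (𝓔.realizes_biprod (realizes_zero_id D) h)
      (⟨biprod.snd, biprod.inr, by ext; simp, by simp⟩ : (0 : C) ⊞ A ≅ A) (Iso.refl _)
      (δ' := pull biprod.snd δ) ?_
    · simpa using this
    · refine Eq.trans ?_ (pull_id _).symm
      rw [map_zero, map_zero, zero_add]
      refine (push_pull _ _ _).trans ?_
      refine congrArg (pull _) ((push_comp _ _ _).symm.trans ?_)
      rw [biprod.inr_snd, push_id]
  obtain ⟨K, d', e', h', δ'', -, hdg, hK, hK', -⟩ := 𝓔.et4_op h₂ h₁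
  have hK'' : 𝓔.Realizes d' e' (pull f δ) := by
    have : pull (biprod.lift (𝟙 D) f) (pull biprod.snd δ) = pull f δ := by
      rw [← pull_comp, biprod.lift_snd]
    exact this ▸ hK'
  obtain ⟨b, -, hb⟩ := (𝓔.realizes_iff hK'' d e).1 hd
  refine ⟨b.inv ≫ h', biprod.map (𝟙 D) y ≫ biprod.desc (-f) (𝟙 Z), ?_, push b.hom δ'', ?_⟩
  · have := hdg =≫ biprod.fst
    rw [Category.assoc, Iso.inv_comp_eq, hb]
    simpa using this.symm
  · simpa using Realizes.of_iso hK b (Iso.refl Z) (δ' := push b.hom δ'') (pull_id _).symm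

end Pushout

end ExtriangulatedStructure

/-! ### Cotorsion pairs: orthogonality, closure properties and comparison of approximations. -/

section ClosureProperties

variable {C : Type u} [Category.{v} C] [Preadditive C] [HasZeroObject C]
  [HasBinaryBiproducts C]

theorem IsAdditiveSubcategory.summand_mem' {P : ObjectProperty C} [IsAdditiveSubcategory P]
    {A B : C} (h : P (A ⊞ B)) : P B :=
  IsAdditiveSubcategory.summand_mem (IsAdditiveSubcategory.iso_mem (biprod.braiding A B) h)

theorem FactorsThrough.of_comp {W : ObjectProperty C} {A B Z : C} (f : A ⟶ Z) (g : Z ⟶ B)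
    (hZ : W Z) : FactorsThrough W (f ≫ g) :=
  ⟨Z, f, g, hZ, rfl⟩

theorem FactorsThrough.comp_left {W : ObjectProperty C} {A B A' : C} (f : A' ⟶ A) {g : A ⟶ B}
    (hg : FactorsThrough W g) : FactorsThrough W (f ≫ g) := by
  obtain ⟨Z, a, b, hZ, rfl⟩ := hg
  exact ⟨Z, f ≫ a, b, hZ, Category.assoc _ _ _⟩

theorem FactorsThrough.comp_right {W : ObjectProperty C} {A B B' : C} {f : A ⟶ B} (g : B ⟶ B')
    (hf : FactorsThrough W f) : FactorsThrough W (f ≫ g) := by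
  obtain ⟨Z, a, b, hZ, rfl⟩ := hf
  exact ⟨Z, a, b ≫ g, hZ, (Category.assoc _ _ _).symm⟩

namespace ExtriangulatedStructure

variable {𝓔 : ExtriangulatedStructure.{w} C}

theorem IsProj.ext_eq_zero {P A : C} (hP : 𝓔.IsProj P) (δ : 𝓔.Ext P A) : δ = 0 := by
  obtain ⟨B, x, y, h⟩ := 𝓔.exists_realizes δ
  obtain ⟨s, hs⟩ := hP x y ⟨δ, h⟩ (𝟙 P)
  exact eq_zero_of_section h s hs

namespace IsCotorsionPair

variable {U V W : ObjectProperty C} [IsAdditiveSubcategory U] [IsAdditiveSubcategory V]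

/-- If all extensions of `A` by `V` vanish, the approximating conflation ending in `A` splits, and
`A` is a summand of an object of `U`. -/
theorem left_iff (h : 𝓔.IsCotorsionPair U V) {A : C} : U A ↔ ∀ B, V B → ∀ δ : 𝓔.Ext A B, δ = 0 := by
  refine ⟨fun hA B hB => h.ext_eq_zero hA hB, fun hA => ?_⟩
  obtain ⟨B, Z, x, y, hB, hZ, δ, hδ⟩ := h.exists_left A
  obtain rfl := hA B hB δ
  obtain ⟨b, -⟩ := exists_iso_biprod hδ
  exact IsAdditiveSubcategory.summand_mem' (IsAdditiveSubcategory.iso_mem b.symm hZ)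

theorem right_iff (h : 𝓔.IsCotorsionPair U V) {B : C} : V B ↔ ∀ A, U A → ∀ δ : 𝓔.Ext A B, δ = 0 := by
  refine ⟨fun hB A hA => h.ext_eq_zero hA hB, fun hB => ?_⟩
  obtain ⟨Z, A, x, y, hZ, hA, δ, hδ⟩ := h.exists_right B
  obtain rfl := hB A hA δ
  obtain ⟨b, -⟩ := exists_iso_biprod hδ
  exact IsAdditiveSubcategory.summand_mem (IsAdditiveSubcategory.iso_mem b.symm hZ)

theorem left_of_isProj (h : 𝓔.IsCotorsionPair U V) {P : C} (hP : 𝓔.IsProj P) : U P :=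
  h.left_iff.2 fun _ _ => hP.ext_eq_zero

theorem left_of_conflation (h : 𝓔.IsCotorsionPair U V) {A B Z : C} {x : A ⟶ B} {y : B ⟶ Z} (hxy : 𝓔.Conflation x y)
    (hA : U A) (hZ : U Z) : U B := by
  obtain ⟨δ, hδ⟩ := hxy
  refine h.left_iff.2 fun N hN β => ?_
  obtain ⟨α, rfl⟩ := hδ.exists_pull_eq β (h.ext_eq_zero hA hN _)
  rw [show α = 0 from h.ext_eq_zero hZ hN α, pull_zero]

theorem right_of_conflation (h : 𝓔.IsCotorsionPair U V) {A B Z : C} {x : A ⟶ B} {y : B ⟶ Z} (hxy : 𝓔.Conflation x y)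
    (hA : V A) (hZ : V Z) : V B := by
  obtain ⟨δ, hδ⟩ := hxy
  refine h.right_iff.2 fun N hN β => ?_
  obtain ⟨α, rfl⟩ := hδ.exists_push_eq β (h.ext_eq_zero hN hZ _)
  rw [show α = 0 from h.ext_eq_zero hN hA α, push_zero]

theorem exists_lift (h : 𝓔.IsCotorsionPair U V) {A B Z M : C} {x : A ⟶ B} {y : B ⟶ Z} (hxy : 𝓔.Conflation x y)
    (hA : V A) (hM : U M) (f : M ⟶ Z) : ∃ g : M ⟶ B, g ≫ y = f := by
  obtain ⟨δ, hδ⟩ := hxy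
  exact hδ.exists_lift f (h.ext_eq_zero hM hA _)

theorem exists_extend (h : 𝓔.IsCotorsionPair U V) {A B Z M : C} {x : A ⟶ B} {y : B ⟶ Z} (hxy : 𝓔.Conflation x y)
    (hZ : U Z) (hM : V M) (f : A ⟶ M) : ∃ g : B ⟶ M, x ≫ g = f := by
  obtain ⟨δ, hδ⟩ := hxy
  exact hδ.exists_extend f (h.ext_eq_zero hZ hM _)

/-- The map lifts to the `U`-approximation of `B`; this is an extension of objects of `V`, hence
lies in the core. -/
theorem factorsThrough (h : 𝓔.IsCotorsionPair U V) {A B : C} (hA : U A) (hB : V B) (f : A ⟶ B) :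
    FactorsThrough (U ⊓ V) f := by
  obtain ⟨N, M, x, y, hN, hM, hxy⟩ := h.exists_left B
  obtain ⟨g, rfl⟩ := h.exists_lift hxy hN hA f
  exact .of_comp _ _ ⟨hM, h.right_of_conflation hxy hN hB⟩

/-- If `ΣV ⊆ V`, then `U` is closed under cocones. -/
theorem left_of_cocone (h : 𝓔.IsCotorsionPair U V) (hinj : 𝓔.EnoughInj) (hV : 𝓔.cosyzygy V ≤ V) {A B Z : C} {x : A ⟶ B}
    {y : B ⟶ Z} (hxy : 𝓔.Conflation x y) (hB : U B) (hZ : U Z) : U A := by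
  refine h.left_iff.2 fun N hN ε => ?_
  -- Dimension shifting: `ε` is the pullback of `η` along some `c : A ⟶ N'` with `N'` in `ΣV ⊆ V`.
  -- Then `c` extends to `B`, the extension lifts to `I`, and `η` dies on `I`.
  obtain ⟨I, N', i, p, hI, η, hη⟩ := hinj N
  have hN' : V N' := hV _ ⟨N, I, i, p, hN, hI, η, hη⟩
  obtain ⟨M, d, e, hde⟩ := 𝓔.exists_realizes ε
  obtain ⟨b, hb⟩ := hI d e ⟨ε, hde⟩ i
  obtain ⟨c, -, hc⟩ := 𝓔.et3 hde hη (𝟙 N) b (by simp [hb])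
  obtain ⟨g, rfl⟩ := h.exists_extend hxy hZ hN' c
  obtain ⟨k, rfl⟩ := h.exists_lift ⟨η, hη⟩ hN hB g
  calc ε = push (𝟙 N) ε := (push_id ε).symm
    _ = pull (x ≫ k ≫ p) η := hc
    _ = 0 := by rw [pull_comp, pull_comp, hη.pull_eq_zero, pull_zero, pull_zero]

/-- If `ΣV ⊆ V`, then `V` is closed under cones. -/
theorem right_of_cone (h : 𝓔.IsCotorsionPair U V) (hproj : 𝓔.EnoughProj) (hinj : 𝓔.EnoughInj) (hV : 𝓔.cosyzygy V ≤ V)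
    {A B Z : C} {x : A ⟶ B} {y : B ⟶ Z} (hxy : 𝓔.Conflation x y) (hA : V A) (hB : V B) :
    V Z := by
  refine h.right_iff.2 fun N hN ε => ?_
  -- The dual shift along a projective; the syzygy `N'` stays in `U` because `U` is closed under
  -- cocones.
  obtain ⟨N', P, i, p, hP, η, hη⟩ := hproj N
  have hN' : U N' := h.left_of_cocone hinj hV ⟨η, hη⟩ (h.left_of_isProj hP) hN
  obtain ⟨M, d, e, hde⟩ := 𝓔.exists_realizes ε
  obtain ⟨b, hb⟩ := hP d e ⟨ε, hde⟩ p
  obtain ⟨c, -, hc⟩ := 𝓔.et3_op hη hde b (𝟙 N) (by simp [hb])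
  obtain ⟨g, rfl⟩ := h.exists_lift hxy hA hN' c
  obtain ⟨k, rfl⟩ := h.exists_extend ⟨η, hη⟩ hN hB g
  calc ε = pull (𝟙 N) ε := (pull_id ε).symm
    _ = push ((i ≫ k) ≫ y) η := hc.symm
    _ = 0 := by rw [push_comp, push_comp, hη.push_eq_zero, push_zero, push_zero]

variable [IsAdditiveSubcategory W]

/-- The factorization of `x ≫ f` extends over `B`. The difference from `f` kills `x`, so it passes
through a map from `Z ∈ U` to `M ∈ V`, which vanishes modulo `W`. -/
theorem factorsThrough_of_inflation (h : 𝓔.IsCotorsionPair U V) (hW : W = U ⊓ V) {A B Z M : C} {x : A ⟶ B} {y : B ⟶ Z}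
    (hxy : 𝓔.Conflation x y) (hZ : U Z) (hM : V M) (f : B ⟶ M)
    (hf : FactorsThrough W (x ≫ f)) : FactorsThrough W f := by
  subst hW
  obtain ⟨N, a, b, hN, hab⟩ := hf
  obtain ⟨c, rfl⟩ := h.exists_extend hxy hZ hN.2 a
  obtain ⟨δ, hδ⟩ := hxy
  obtain ⟨g, hg⟩ := hδ.exists_factor_right (f - c ≫ b) (by simp [← hab])
  rw [← sub_add_cancel f (c ≫ b), ← hg]
  exact .sum _ ((h.factorsThrough hZ hM g).comp_left y) (.of_comp _ _ hN)

theorem factorsThrough_of_deflation (h : 𝓔.IsCotorsionPair U V) (hW : W = U ⊓ V) {A B Z M : C} {x : A ⟶ B} {y : B ⟶ Z}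
    (hxy : 𝓔.Conflation x y) (hA : V A) (hM : U M) (f : M ⟶ B)
    (hf : FactorsThrough W (f ≫ y)) : FactorsThrough W f := by
  subst hW
  obtain ⟨N, a, b, hN, hab⟩ := hf
  obtain ⟨c, rfl⟩ := h.exists_lift hxy hA hN.1 b
  obtain ⟨δ, hδ⟩ := hxy
  obtain ⟨g, hg⟩ := hδ.exists_factor_left (f - a ≫ c) (by simp [← hab])
  rw [← sub_add_cancel f (a ≫ c), ← hg]
  exact .sum _ ((h.factorsThrough hM hA g).comp_right x) (.of_comp _ _ hN)

/-- Composition with `x : A ⟶ B` is bijective on morphisms from objects of `U` modulo `W = U ∩ V`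
if the cone `Z` of `x` has a conflation `K ⟶ P ⟶ Z` with `K ∈ V` and `P ∈ W`. -/
theorem bijective_comp_inflation (h : 𝓔.IsCotorsionPair U V) (hW : W = U ⊓ V) {A B Z K P : C} {x : A ⟶ B} {y : B ⟶ Z}
    (hxy : 𝓔.Conflation x y) {i : K ⟶ P} {p : P ⟶ Z} (hip : 𝓔.Conflation i p) (hK : V K)
    (hP : W P) (hPA : ∀ δ : 𝓔.Ext P A, δ = 0) {M : C} (hM : U M) :
    (∀ f : M ⟶ B, ∃ g : M ⟶ A, FactorsThrough W (f - g ≫ x)) ∧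
      ∀ g : M ⟶ A, FactorsThrough W (g ≫ x) → FactorsThrough W g := by
  obtain ⟨δ, hδ⟩ := hxy
  obtain ⟨η, hη⟩ := hip
  -- Lifting `p` exhibits `δ` as a pushforward of `η`, which gives a conflation `K ⟶ A ⊞ P ⟶ B`.
  -- Maps from `U` lift along it uniquely modulo `W`, and `P` is zero modulo `W`.
  obtain ⟨q, hq⟩ := hδ.exists_lift p (hPA _)
  obtain ⟨a, -, ha⟩ := 𝓔.et3_op hη hδ q (𝟙 Z) (by simp [hq])
  have ha' : push a η = δ := ha.trans (pull_id δ)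
  obtain ⟨j, r, hr, hjr⟩ := exists_conflation_of_push hη a (ha'.symm ▸ hδ)
  constructor
  · intro f
    obtain ⟨k, rfl⟩ := h.exists_lift hjr hK hM f
    refine ⟨k ≫ biprod.fst, ?_⟩
    have : k ≫ r - (k ≫ biprod.fst) ≫ x = (k ≫ biprod.snd) ≫ biprod.inr ≫ r := by
      rw [← hr, sub_eq_iff_eq_add', ← Category.assoc, ← Category.assoc, ← Preadditive.add_comp,
        Category.assoc, Category.assoc, ← Preadditive.comp_add, biprod.total, Category.comp_id]
    rw [this]
    exact .of_comp _ _ hP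
  · intro g hg
    have := h.factorsThrough_of_deflation hW hjr hK hM (g ≫ biprod.inl)
      (by rwa [Category.assoc, hr])
    simpa using this.comp_right biprod.fst

/-- Composition with `y : B ⟶ Z` is bijective on morphisms to objects of `V` modulo `W = U ∩ V`
if `B` and `Z` belong to the left part `S` of a cotorsion pair `(S, T)` with the same core `W`, and
the cocone `A` of `y` has a conflation `A ⟶ P ⟶ K` with `K ∈ U ∩ S` and `P ∈ T`. -/
theorem bijective_comp_deflation (h : 𝓔.IsCotorsionPair U V) {S T : ObjectProperty C}
    [IsAdditiveSubcategory S] [IsAdditiveSubcategory T] (h' : 𝓔.IsCotorsionPair S T)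
    (hW : W = U ⊓ V) (hW' : W = S ⊓ T) {A B Z K P : C} {x : A ⟶ B} {y : B ⟶ Z}
    (hxy : 𝓔.Conflation x y) {i : A ⟶ P} {p : P ⟶ K} (hip : 𝓔.Conflation i p) (hB : S B)
    (hZ : S Z) (hK : U K) (hK' : S K) (hPT : T P) {M : C} (hM : V M) :
    (∀ f : B ⟶ M, ∃ g : Z ⟶ M, FactorsThrough W (f - y ≫ g)) ∧
      ∀ g : Z ⟶ M, FactorsThrough W (y ≫ g) → FactorsThrough W g := by
  obtain ⟨δ, hδ⟩ := hxy
  obtain ⟨η, hη⟩ := hip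
  -- Extending `i` exhibits `δ` as a pullback of `η`, which gives a conflation `B ⟶ Z ⊞ P ⟶ K`.
  obtain ⟨q, hq⟩ := hδ.exists_extend i (h'.ext_eq_zero hZ hPT _)
  obtain ⟨c, -, hc⟩ := 𝓔.et3 hδ hη (𝟙 A) q (by simp [hq])
  have hc' : pull c η = δ := hc.symm.trans (push_id δ)
  obtain ⟨j, r, hr, hjr⟩ := exists_conflation_of_pull hη c (hc'.symm ▸ hδ)
  -- `Z ⊞ P` is an extension of objects of `S`, so its summand `P` lies in `S ∩ T`.
  have hP : W P := hW' ▸ ⟨IsAdditiveSubcategory.summand_mem' (h'.left_of_conflation hjr hB hK'), hPT⟩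
  constructor
  · intro f
    obtain ⟨k, rfl⟩ := h.exists_extend hjr hK hM f
    refine ⟨biprod.inl ≫ k, ?_⟩
    have : j ≫ k - y ≫ biprod.inl ≫ k = (j ≫ biprod.snd) ≫ biprod.inr ≫ k := by
      rw [← hr, sub_eq_iff_eq_add']
      simp only [Category.assoc]
      rw [← Preadditive.comp_add, ← Category.assoc, ← Category.assoc biprod.snd,
        ← Preadditive.add_comp, biprod.total, Category.id_comp]
    rw [this]
    exact .of_comp _ _ hP
  · intro g hg
    have := h.factorsThrough_of_inflation hW hjr hK hM (biprod.fst ≫ g)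
      (by rwa [reassoc_of% hr])
    simpa using this.comp_left biprod.inl

end IsCotorsionPair

end ExtriangulatedStructure

end ClosureProperties

universe v₁ u₁ v₂ u₂ v₃ u₃

/-! ### Adjoints from universal arrows, and gluing a reflection with a coreflection. -/

section Adjoints

variable {𝒟 : Type u₁} [Category.{v₁} 𝒟] {𝒜 : Type u₂} [Category.{v₂} 𝒜]

/-- The unit is recorded because the later arguments need the concrete approximation behind it. -/
theorem exists_leftAdjoint (G : 𝒟 ⥤ 𝒜) (r : 𝒜 → 𝒟) (η : ∀ M, M ⟶ G.obj (r M))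
    (hη : ∀ M N, Function.Bijective fun f : r M ⟶ N => η M ≫ G.map f) :
    ∃ (L : 𝒜 ⥤ 𝒟) (adj : L ⊣ G), ∀ M, ∃ e : L.obj M ≅ r M, adj.unit.app M = η M ≫ G.map e.inv := by
  refine ⟨_, Adjunction.adjunctionOfEquivLeft (G := G) (F_obj := r)
    (fun M N => Equiv.ofBijective _ (hη M N)) (by intros; simp), fun M => ⟨Iso.refl _, ?_⟩⟩
  simp [Adjunction.adjunctionOfEquivLeft]

theorem exists_rightAdjoint (F : 𝒟 ⥤ 𝒜) (r : 𝒜 → 𝒟) (ε : ∀ M, F.obj (r M) ⟶ M)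
    (hε : ∀ M N, Function.Bijective fun f : N ⟶ r M => F.map f ≫ ε M) :
    ∃ (R : 𝒜 ⥤ 𝒟) (adj : F ⊣ R), ∀ M, ∃ e : R.obj M ≅ r M, adj.counit.app M = F.map e.hom ≫ ε M := by
  refine ⟨_, Adjunction.adjunctionOfEquivRight (F := F) (G_obj := r)
    (fun N M => (Equiv.ofBijective _ (hε M N)).symm) (by
      intro X' X Y f g
      obtain ⟨g, rfl⟩ := (hε Y X).surjective g
      rw [Equiv.symm_apply_eq, Equiv.ofBijective_symm_apply_apply]
      simp), fun M => ⟨Iso.refl _, ?_⟩⟩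
  simp [Adjunction.adjunctionOfEquivRight]

variable {𝒩 : Type u₃} [Category.{v₃} 𝒩] {i : 𝒟 ⥤ 𝒜} {J' : 𝒜 ⥤ 𝒟}
  {J : 𝒜 ⥤ 𝒩} {k : 𝒩 ⥤ 𝒜}

/-- Yoneda: under the adjunction, composing with `J'.map f` becomes composing with `f` on maps out
of `i.obj X`. -/
theorem CategoryTheory.Adjunction.isIso_right_map (adj' : i ⊣ J') {M N : 𝒜} (f : M ⟶ N)
    (hf : ∀ X, Function.Bijective fun g : i.obj X ⟶ M => g ≫ f) : IsIso (J'.map f) := by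
  rw [isIso_iff_yoneda_map_bijective]
  intro X
  have h := (adj'.homEquiv X N).bijective.comp ((hf X).comp (adj'.homEquiv X M).symm.bijective)
  convert h using 2 with g
  simp [Adjunction.homEquiv_naturality_right]

theorem CategoryTheory.Adjunction.isIso_left_map (adj : J ⊣ k) {M N : 𝒜} (f : M ⟶ N)
    (hf : ∀ X, Function.Bijective fun g : N ⟶ k.obj X => f ≫ g) : IsIso (J.map f) := by
  rw [isIso_iff_coyoneda_map_bijective]
  intro X
  have h := (adj.homEquiv M X).symm.bijective.comp ((hf X).comp (adj.homEquiv N X).bijective)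
  convert h using 2 with g
  simp [Adjunction.homEquiv_naturality_left_symm]

variable [i.Full] [i.Faithful] [k.Full] [k.Faithful]

/-- A coreflection `J'` and a reflection `J` of `𝒜` that invert the same morphisms extend to
adjoint triples. -/
theorem exists_adjoint_triples (adj' : i ⊣ J') (adj : J ⊣ k)
    (h : ∀ M, IsIso (J'.map (adj.unit.app M)))
    (h' : ∀ M, IsIso (J.map (adj'.counit.app M))) :
    Nonempty (J ≅ J' ⋙ i ⋙ J) ∧ Nonempty (J' ≅ J ⋙ k ⋙ J') ∧
      (∃ L : 𝒩 ⥤ 𝒜, Nonempty (L ⊣ J) ∧ L.Full ∧ L.Faithful) ∧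
      ∃ R : 𝒟 ⥤ 𝒜, Nonempty (J' ⊣ R) ∧ R.Full ∧ R.Faithful := by
  have h₁ (X : 𝒟) : IsIso ((adj'.comp adj).unit.app X) := by
    simp only [Adjunction.comp_unit_app]
    infer_instance
  have h₂ (N : 𝒩) : IsIso ((adj'.comp adj).counit.app N) := by
    simp only [Adjunction.comp_counit_app]
    infer_instance
  -- The unit and counit of `i ⋙ J ⊣ k ⋙ J'` are invertible by `h`, `h'` and full faithfulness of
  -- `i` and `k`.
  let e : 𝒟 ≌ 𝒩 := (adj'.comp adj).toEquivalence
  let α : J' ⋙ i ⋙ J ≅ J := NatIso.ofComponents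
    (fun M => @asIso _ _ _ _ (J.map (adj'.counit.app M)) (h' M))
    (by intros; simp [← Functor.map_comp])
  let β : J' ≅ J ⋙ k ⋙ J' := NatIso.ofComponents
    (fun M => @asIso _ _ _ _ (J'.map (adj.unit.app M)) (h M))
    (by intros; simp [← Functor.map_comp])
  -- By `α` and `β`, `J` is `J'` followed by `e`, and `J'` is `J` followed by the inverse of `e`;
  -- adjoints transport along `e`.
  have a₁ : e.inverse ⋙ i ⊣ J' ⋙ i ⋙ J := e.symm.toAdjunction.comp adj'
  have a₂ : J ⋙ k ⋙ J' ⊣ e.functor ⋙ k := adj.comp e.symm.toAdjunction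
  exact ⟨⟨α.symm⟩, ⟨β⟩, ⟨_, ⟨a₁.ofNatIsoRight α⟩, inferInstance, inferInstance⟩,
    ⟨_, ⟨a₂.ofNatIsoLeft β.symm⟩, inferInstance, inferInstance⟩⟩

end Adjoints

/-! ### Morphisms, zero objects and adjoints of inclusions in `P/W`. -/

section Quotients

variable {C : Type u} [Category.{v} C] [Preadditive C] [HasZeroObject C]
  [HasBinaryBiproducts C] (W : ObjectProperty C) [IsAdditiveSubcategory W]

/-- The morphism of `P/W` represented by a morphism of `C`. -/
def quotientHom {P : ObjectProperty C} {A B : QuotientSubcategory W P}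
    (f : A.obj.as ⟶ B.obj.as) : A ⟶ B :=
  ObjectProperty.homMk ((toIdealQuotient W).map f)

variable {W} {P : ObjectProperty C} {A B Z : QuotientSubcategory W P}

theorem quotientHom_surjective (f : A ⟶ B) : ∃ g, quotientHom W g = f := by
  obtain ⟨g, hg⟩ := (toIdealQuotient W).map_surjective f.hom
  exact ⟨g, ObjectProperty.hom_ext _ hg⟩

theorem quotientHom_eq_iff (f g : A.obj.as ⟶ B.obj.as) :
    quotientHom W f = quotientHom W g ↔ FactorsThrough W (f - g) := by
  rw [← toIdealQuotient_map_eq_iff]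
  exact ⟨fun h => congrArg (·.hom) h, fun h => ObjectProperty.hom_ext _ h⟩

theorem quotientHom_comp (f : A.obj.as ⟶ B.obj.as) (g : B.obj.as ⟶ Z.obj.as) :
    quotientHom W f ≫ quotientHom W g = quotientHom W (f ≫ g) :=
  ObjectProperty.hom_ext _ ((toIdealQuotient W).map_comp f g).symm

theorem quotientHom_precomp_bijective (x : A.obj.as ⟶ B.obj.as)
    (hx : (∀ f : A.obj.as ⟶ Z.obj.as, ∃ g : B.obj.as ⟶ Z.obj.as, FactorsThrough W (f - x ≫ g)) ∧
      ∀ g : B.obj.as ⟶ Z.obj.as, FactorsThrough W (x ≫ g) → FactorsThrough W g) :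
    Function.Bijective fun f : B ⟶ Z => quotientHom W x ≫ f := by
  constructor
  · intro f g hfg
    obtain ⟨f, rfl⟩ := quotientHom_surjective f
    obtain ⟨g, rfl⟩ := quotientHom_surjective g
    simp only [quotientHom_comp, quotientHom_eq_iff] at hfg ⊢
    exact hx.2 _ (by rwa [Preadditive.comp_sub])
  · intro f
    obtain ⟨f, rfl⟩ := quotientHom_surjective f
    obtain ⟨g, hg⟩ := hx.1 f
    exact ⟨quotientHom W g, by
      simpa only [quotientHom_comp] using ((quotientHom_eq_iff _ _).2 hg).symm⟩

theorem quotientHom_postcomp_bijective (y : A.obj.as ⟶ B.obj.as)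
    (hy : (∀ f : Z.obj.as ⟶ B.obj.as, ∃ g : Z.obj.as ⟶ A.obj.as, FactorsThrough W (f - g ≫ y)) ∧
      ∀ g : Z.obj.as ⟶ A.obj.as, FactorsThrough W (g ≫ y) → FactorsThrough W g) :
    Function.Bijective fun f : Z ⟶ A => f ≫ quotientHom W y := by
  constructor
  · intro f g hfg
    obtain ⟨f, rfl⟩ := quotientHom_surjective f
    obtain ⟨g, rfl⟩ := quotientHom_surjective g
    simp only [quotientHom_comp, quotientHom_eq_iff] at hfg ⊢
    exact hy.2 _ (by rwa [Preadditive.sub_comp])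
  · intro f
    obtain ⟨f, rfl⟩ := quotientHom_surjective f
    obtain ⟨g, hg⟩ := hy.1 f
    exact ⟨quotientHom W g, by
      simpa only [quotientHom_comp] using ((quotientHom_eq_iff _ _).2 hg).symm⟩

theorem isZero_quotient_iff : IsZero A ↔ FactorsThrough W (𝟙 A.obj.as) := by
  rw [IsZero.iff_id_eq_zero]
  have h : (𝟙 A = 0) ↔ quotientHom W (𝟙 A.obj.as) = quotientHom W (A := A) (B := A) 0 := by
    rw [show quotientHom W (𝟙 A.obj.as) = 𝟙 A from
      ObjectProperty.hom_ext _ ((toIdealQuotient W).map_id _),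
      show quotientHom W (A := A) (B := A) 0 = 0 from
      ObjectProperty.hom_ext _ ((toIdealQuotient W).map_zero _ _)]
  rw [h, quotientHom_eq_iff, sub_zero]

theorem quotientInclusion_map_bijective {P' : ObjectProperty C} (h : P ≤ P') :
    Function.Bijective ((quotientInclusion (W := W) h).map : (A ⟶ B) → _) :=
  (ObjectProperty.fullyFaithfulιOfLE _).map_bijective _ _

/-- `P/W` is reflective in `P'/W` if objects of `P'` have left approximations in `P` that are
unique modulo `W`. -/
theorem exists_leftAdjoint_quotientInclusion {P' : ObjectProperty C} (h : P ≤ P') (r : C → C)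
    (hr : ∀ M, P' M → P (r M)) (m : ∀ M, M ⟶ r M)
    (hm : ∀ M N, P' M → P N → (∀ f : M ⟶ N, ∃ g : r M ⟶ N, FactorsThrough W (f - m M ≫ g)) ∧
      ∀ g : r M ⟶ N, FactorsThrough W (m M ≫ g) → FactorsThrough W g) :
    ∃ (L : QuotientSubcategory W P' ⥤ QuotientSubcategory W P) (adj : L ⊣ quotientInclusion h),
      ∀ M, ∃ e : L.obj M ≅ ⟨⟨r M.obj.as⟩, hr _ M.property⟩,
        adj.unit.app M = quotientHom W (m M.obj.as) ≫ (quotientInclusion h).map e.inv :=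
  exists_leftAdjoint (quotientInclusion (W := W) h) (fun M => ⟨⟨r M.obj.as⟩, hr _ M.property⟩)
    (fun M => quotientHom W (m M.obj.as)) fun M N =>
      (quotientHom_precomp_bijective (Z := (quotientInclusion (W := W) h).obj N) _
        (hm _ _ M.property N.property)).comp (quotientInclusion_map_bijective h)

/-- `P/W` is coreflective in `P'/W` if objects of `P'` have right approximations in `P` that are
unique modulo `W`. -/
theorem exists_rightAdjoint_quotientInclusion {P' : ObjectProperty C} (h : P ≤ P') (r : C → C)
    (hr : ∀ M, P' M → P (r M)) (m : ∀ M, r M ⟶ M)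
    (hm : ∀ M N, P' M → P N → (∀ f : N ⟶ M, ∃ g : N ⟶ r M, FactorsThrough W (f - g ≫ m M)) ∧
      ∀ g : N ⟶ r M, FactorsThrough W (g ≫ m M) → FactorsThrough W g) :
    ∃ (R : QuotientSubcategory W P' ⥤ QuotientSubcategory W P) (adj : quotientInclusion h ⊣ R),
      ∀ M, ∃ e : R.obj M ≅ ⟨⟨r M.obj.as⟩, hr _ M.property⟩,
        adj.counit.app M = (quotientInclusion h).map e.hom ≫ quotientHom W (m M.obj.as) :=
  exists_rightAdjoint (quotientInclusion (W := W) h) (fun M => ⟨⟨r M.obj.as⟩, hr _ M.property⟩)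
    (fun M => quotientHom W (m M.obj.as)) fun M N =>
      (quotientHom_postcomp_bijective (Z := (quotientInclusion (W := W) h).obj N)
        (A := (quotientInclusion (W := W) h).obj ⟨⟨r M.obj.as⟩, hr _ M.property⟩) (B := M) _
        (hm _ _ M.property N.property)).comp (quotientInclusion_map_bijective h)

end Quotients

/-! ### Reflections and coreflections given by a cotorsion pair. -/

section Recollements

variable {C : Type u} [Category.{v} C] [Preadditive C] [HasZeroObject C]
  [HasBinaryBiproducts C] {W : ObjectProperty C} [IsAdditiveSubcategory W]

theorem FactorsThrough.of_eq {A B : C} {f g : A ⟶ B} (h : f = g) : FactorsThrough W (f - g) :=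
  ⟨0, 0, 0, IsAdditiveSubcategory.zero_mem (isZero_zero C), by simp [h]⟩

instance quotientInclusion_additive {P Q : ObjectProperty C} (h : P ≤ Q) :
    (quotientInclusion (W := W) h).Additive where
  map_add := rfl

instance quotientInclusion_full {P Q : ObjectProperty C} (h : P ≤ Q) :
    (quotientInclusion (W := W) h).Full :=
  (ObjectProperty.fullyFaithfulιOfLE _).full

instance quotientInclusion_faithful {P Q : ObjectProperty C} (h : P ≤ Q) :
    (quotientInclusion (W := W) h).Faithful :=
  (ObjectProperty.fullyFaithfulιOfLE _).faithful

namespace ExtriangulatedStructure.IsCotorsionPair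

variable {𝓔 : ExtriangulatedStructure.{w} C} {U V : ObjectProperty C} [IsAdditiveSubcategory U]
  [IsAdditiveSubcategory V]

/-- A retract need not have a complement, so closure under summands does not suffice; vanishing of
extensions does pass to retracts. -/
theorem left_of_retract (h : 𝓔.IsCotorsionPair U V) {A B : C} (i : A ⟶ B) (r : B ⟶ A)
    (hir : i ≫ r = 𝟙 A) (hB : U B) : U A := by
  refine h.left_iff.2 fun N hN δ => ?_
  rw [← pull_id δ, ← hir, pull_comp, h.ext_eq_zero hB hN (pull r δ), pull_zero]

theorem right_of_retract (h : 𝓔.IsCotorsionPair U V) {A B : C} (i : A ⟶ B) (r : B ⟶ A)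
    (hir : i ≫ r = 𝟙 A) (hB : V B) : V A := by
  refine h.right_iff.2 fun N hN δ => ?_
  rw [← push_id δ, ← hir, push_comp, h.ext_eq_zero hN hB (push i δ), push_zero]

theorem isZero_quotient_iff (h : 𝓔.IsCotorsionPair U V) (hW : W = U ⊓ V) {P : ObjectProperty C}
    (A : QuotientSubcategory W P) : IsZero A ↔ W A.obj.as := by
  rw [_root_.isZero_quotient_iff]
  constructor
  · rintro ⟨Z, i, r, hZ, hir⟩
    subst hW
    exact ⟨h.left_of_retract i r hir hZ.1, h.right_of_retract i r hir hZ.2⟩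
  · intro hA
    exact ⟨_, 𝟙 _, 𝟙 _, hA, Category.comp_id _⟩

/-- Left approximations by `V` give a reflection of `P'/W` onto `P/W` for `P = P' ∩ V`. -/
theorem exists_reflection (h : 𝓔.IsCotorsionPair U V) (hW : W = U ⊓ V) {P P' : ObjectProperty C}
    (hP : P ≤ P') (hPV : P ≤ V)
    (hP' : ∀ {A B Z : C} {x : A ⟶ B} {y : B ⟶ Z}, 𝓔.Conflation x y → P' A → V B → U Z → P B) :
    ∃ (L : QuotientSubcategory W P' ⥤ QuotientSubcategory W P) (adj : L ⊣ quotientInclusion hP),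
      ∀ M, ∃ (B Z : C) (x : M.obj.as ⟶ B) (y : B ⟶ Z) (hB : P B) (e : L.obj M ≅ ⟨⟨B⟩, hB⟩),
        V B ∧ U Z ∧ 𝓔.Conflation x y ∧
          adj.unit.app M = quotientHom W x ≫ (quotientInclusion hP).map e.inv := by
  choose r Z m y hr hZ hm using h.exists_right
  obtain ⟨L, adj, hL⟩ := exists_leftAdjoint_quotientInclusion (W := W) hP r
    (fun M hM => hP' (hm M) hM (hr M) (hZ M)) m (fun M N _ hN =>
      ⟨fun f => (h.exists_extend (hm M) (hZ M) (hPV _ hN) f).imp fun g hg => .of_eq hg.symm,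
        h.factorsThrough_of_inflation hW (hm M) (hZ M) (hPV _ hN)⟩)
  refine ⟨L, adj, fun M => ?_⟩
  obtain ⟨e, he⟩ := hL M
  exact ⟨_, _, _, _, hP' (hm _) M.property (hr _) (hZ _), e, hr _, hZ _, hm _, he⟩

/-- Right approximations by `U` give a coreflection of `P'/W` onto `P/W` for `P = P' ∩ U`. -/
theorem exists_coreflection (h : 𝓔.IsCotorsionPair U V) (hW : W = U ⊓ V)
    {P P' : ObjectProperty C} (hP : P ≤ P') (hPU : P ≤ U)
    (hP' : ∀ {A B Z : C} {x : A ⟶ B} {y : B ⟶ Z}, 𝓔.Conflation x y → V A → U B → P' Z → P B) :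
    ∃ (R : QuotientSubcategory W P' ⥤ QuotientSubcategory W P) (adj : quotientInclusion hP ⊣ R),
      ∀ M, ∃ (A B : C) (x : A ⟶ B) (y : B ⟶ M.obj.as) (hB : P B) (e : R.obj M ≅ ⟨⟨B⟩, hB⟩),
        V A ∧ U B ∧ 𝓔.Conflation x y ∧
          adj.counit.app M = (quotientInclusion hP).map e.hom ≫
            quotientHom W (A := ⟨⟨B⟩, hP _ hB⟩) y := by
  choose Z r y m hZ hr hm using h.exists_left
  obtain ⟨L, adj, hL⟩ := exists_rightAdjoint_quotientInclusion (W := W) hP r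
    (fun M hM => hP' (hm M) (hZ M) (hr M) hM) m (fun M N _ hN =>
      ⟨fun f => (h.exists_lift (hm M) (hZ M) (hPU _ hN) f).imp fun g hg => .of_eq hg.symm,
        h.factorsThrough_of_deflation hW (hm M) (hZ M) (hPU _ hN)⟩)
  refine ⟨L, adj, fun M => ?_⟩
  obtain ⟨e, he⟩ := hL M
  exact ⟨_, _, _, _, hP' (hm _) (hZ _) (hr _) M.property, e, hZ _, hr _, hm _, he⟩

end ExtriangulatedStructure.IsCotorsionPair

end Recollements

/-! ### The two recollements. -/

theorem theorem3p9 {C : Type u} [Category.{v} C] [Preadditive C] [HasZeroObject C]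
    [HasBinaryBiproducts C]
    (𝓔 : ExtriangulatedStructure.{w} C) (hproj : 𝓔.EnoughProj) (hinj : 𝓔.EnoughInj)
    (S T U V X Y : ObjectProperty C)
    [IsAdditiveSubcategory S] [IsAdditiveSubcategory T] [IsAdditiveSubcategory U]
    [IsAdditiveSubcategory V] [IsAdditiveSubcategory X] [IsAdditiveSubcategory Y]
    (hST : 𝓔.IsCotorsionPair S T) (hUV : 𝓔.IsCotorsionPair U V) (hXY : 𝓔.IsCotorsionPair X Y)
    -- the common core is `W = S ⊓ T`
    (hWU : S ⊓ T = U ⊓ V) (hWX : S ⊓ T = X ⊓ Y)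
    (hYS : Y ⊓ S = U) (hXS : X ≤ S) (hV : 𝓔.cosyzygy V ≤ V) (hY : 𝓔.cosyzygy Y ≤ Y) :
    ∃ (J : QuotientSubcategory (S ⊓ T) S ⥤ QuotientSubcategory (S ⊓ T) (S ⊓ V))
      (J' : QuotientSubcategory (S ⊓ T) S ⥤ QuotientSubcategory (S ⊓ T) X)
      -- both recollements start with the inclusion `I : U/W ⥤ S/W`
      (R : Recollement (quotientInclusion (W := S ⊓ T) (hYS.ge.trans inf_le_right : U ≤ S)) J)
      (R' : Recollement (quotientInclusion (W := S ⊓ T) (hYS.ge.trans inf_le_right : U ≤ S)) J'),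
      -- both recollements have the same adjoints `I_λ` and `I_ρ` of `I`
      R.coloc.Fl = R'.coloc.Fl ∧ R.loc.Fρ = R'.loc.Fρ ∧
      -- the right adjoint of `J` and the left adjoint of `J'` are the inclusions into `S/W`
      R.loc.Gρ = quotientInclusion inf_le_left ∧ R'.coloc.Gl = quotientInclusion hXS := by
  have hUS : U ≤ S := hYS.ge.trans inf_le_right
  have hUY : U ≤ Y := hYS.ge.trans inf_le_left
  have hTY : T ≤ Y := fun A hA => hXY.right_iff.2 fun B hB => hST.ext_eq_zero (hXS _ hB) hA
  obtain ⟨Il, adjIl, -⟩ := hXY.exists_reflection hWX hUS hUY fun hxy hA hB hZ =>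
    hYS.le _ ⟨hB, hST.left_of_conflation hxy hA (hXS _ hZ)⟩
  obtain ⟨Ir, adjIr, -⟩ := hUV.exists_coreflection hWU hUS le_rfl fun _ _ hB _ => hB
  obtain ⟨J, adjJ, hJ⟩ := hUV.exists_reflection hWU (P := S ⊓ V) (P' := S) inf_le_left inf_le_right
    fun hxy hA hB hZ => ⟨hST.left_of_conflation hxy hA (hUS _ hZ), hB⟩
  obtain ⟨J', adjJ', hJ'⟩ := hXY.exists_coreflection hWX hXS le_rfl fun _ _ hB _ => hB
  have hη (M) : IsIso (J'.map (adjJ.unit.app M)) := by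
    obtain ⟨B, Z, x, y, hB, e, hBV, hZ, hxy, he⟩ := hJ M
    -- The cone `Z` of the unit lies in `U`. A projective cover term `P` lies in `X` and in `U ⊆ Y`,
    -- hence in `W`, and the syzygy `K` lies in `U ⊆ Y`.
    obtain ⟨K, P, i, p, hP, hip⟩ := hproj Z
    have hPU : U P := hUV.left_of_isProj hP
    have hPW : (S ⊓ T) P := hWX ▸ ⟨hXY.left_of_isProj hP, hUY _ hPU⟩
    have hK : Y K := hUY _ (hUV.left_of_cocone hinj hV hip hPU hZ)
    have : IsIso (J'.map (quotientHom (S ⊓ T) (A := M)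
        (B := (quotientInclusion inf_le_left).obj ⟨⟨B⟩, hB⟩) x)) :=
      adjJ'.isIso_right_map _ fun N => quotientHom_postcomp_bijective _
        (hXY.bijective_comp_inflation hWX hxy hip hK hPW (hP.ext_eq_zero ·) N.property)
    rw [he, Functor.map_comp]
    infer_instance
  have hε (M) : IsIso (J.map (adjJ'.counit.app M)) := by
    obtain ⟨A, B, x, y, hB, e, hA, -, hxy, he⟩ := hJ' M
    -- The cocone `A` of the counit lies in `Y`. Since `T ⊆ Y` and `Y` is closed under cones, `K`
    -- lies in `Y ∩ S = U`.
    obtain ⟨P, K, i, p, hP, hK, hip⟩ := hST.exists_right A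
    have hKU : U K := hYS.le _ ⟨hXY.right_of_cone hproj hinj hY hip hA (hTY _ hP), hK⟩
    have : IsIso (J.map (quotientHom (S ⊓ T)
        (A := (quotientInclusion hXS).obj ⟨⟨B⟩, hB⟩) (B := M) y)) :=
      adjJ.isIso_left_map _ fun N => quotientHom_precomp_bijective _
        (hUV.bijective_comp_deflation hST hWU rfl hxy hip (hXS _ hB) M.property hKU hK hP
          N.property.2)
    rw [he, Functor.map_comp]
    infer_instance
  obtain ⟨⟨α⟩, ⟨β⟩, ⟨Jl, ⟨adjJl⟩, hJl, hJl'⟩, ⟨Jr, ⟨adjJr⟩, hJr, hJr'⟩⟩ :=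
    exists_adjoint_triples adjJ' adjJ hη hε
  have : J.Additive := adjJ.left_adjoint_additive
  have : J'.Additive := adjJ'.right_adjoint_additive
  have hzero (M) : (quotientInclusion hUS).essImage M ↔ IsZero (J.obj M) := by
    constructor
    · rintro ⟨N, ⟨f⟩⟩
      refine IsZero.of_iso ?_ (J.mapIso f.symm)
      obtain ⟨B, Z, x, y, hB, e, hBV, hZ, hxy, -⟩ := hJ ((quotientInclusion hUS).obj N)
      refine IsZero.of_iso ((hUV.isZero_quotient_iff hWU _).2 ?_) e
      exact hWU ▸ ⟨hUV.left_of_conflation hxy N.property hZ, hBV⟩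
    · intro hM
      obtain ⟨B, Z, x, y, hB, e, hBV, hZ, hxy, -⟩ := hJ M
      -- `J.obj M` is zero exactly when the approximation `B` is in `W`; then `M` is the cocone of a
      -- map in `U`.
      have hBW : (U ⊓ V) B := hWU ▸ (hUV.isZero_quotient_iff hWU _).1 (hM.of_iso e.symm)
      exact ⟨⟨M.obj, hUV.left_of_cocone hinj hV hxy hBW.1 hZ⟩, ⟨Iso.refl _⟩⟩
  have hzero' (M) : (quotientInclusion hUS).essImage M ↔ IsZero (J'.obj M) := by
    rw [hzero]
    -- Each of `J` and `J'` factors through the other up to isomorphism, so they have the same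
    -- kernel.
    exact ⟨fun h => ((quotientInclusion inf_le_left ⋙ J').map_isZero h).of_iso (β.app M),
      fun h => ((quotientInclusion hXS ⋙ J).map_isZero h).of_iso (α.app M)⟩
  exact ⟨J, J',
    { loc := ⟨inferInstance, inferInstance, inferInstance, inferInstance, Ir, adjIr, _, adjJ,
        inferInstance, inferInstance, hzero⟩
      coloc := ⟨inferInstance, inferInstance, inferInstance, inferInstance, Il, adjIl, Jl, adjJl,
        hJl, hJl', hzero⟩ },
    { loc := ⟨inferInstance, inferInstance, inferInstance, inferInstance, Ir, adjIr, Jr, adjJr,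
        hJr, hJr', hzero'⟩
      coloc := ⟨inferInstance, inferInstance, inferInstance, inferInstance, Il, adjIl, _, adjJ',
        inferInstance, inferInstance, hzero'⟩ }, rfl, rfl, rfl, rfl⟩
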